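/- **Theorem.** Let $\beta$ be a complex random variable with $\mathbf E|\beta|<\infty$, $\mathbf E\beta=0$ and $\Pr\{|\beta|>c\}\ge c'$ for some $c,c'>0$, and let $\overline C>0$. Then there is a constant $C>0$, depending only on the distribution of $\beta$ and on $\overline C$, such that the following holds. Let $n\ge 1$ and $p_n\in(0,1]$, let $\beta_1,\dots,\beta_n$ be independent copies of $\beta$, and let $\varepsilon_1,\dots,\varepsilon_n$ be i.i.d. Bernoulli random variables with $\Pr\{\varepsilon_j=1\}=p_n=1-\Pr\{\varepsilon_j=0\}$, independent of $(\beta_1,\dots,\beta_n)$. Let $x=(x_1,\dots,x_n)\in\mathbb C^n$ and $a>0$ be such that $a<|x_j|<\overline C a$ for all $j$. Then for every $\Delta$ with $0<\Delta<\frac{a}{2\pi}$, every $j_0\in\{1,\dots,n\}$ and all $u,v\in\mathbb C$, $$ \Pr\Bigl\{\Bigl|\sum_{j=1}^n\varepsilon_j\beta_jx_j-\sqrt{np_n}\,u\,x_{j_0}-\sqrt{np_n}\,v\Bigr|<\Delta\Bigr\}\le\frac{C}{(np_n)^{5/2}}\sum_{k=1}^\infty P_k(x,\Delta)^2, $$ where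 $P_k(x,\Delta)=\#\{j:\ |x_j|\in(k\Delta,(k+1)\Delta]\}$. -/

import Mathlib

/-- `profileCount x Δ k` is the number `P_k(x, Δ)` of indices `j` with `|x_j| ∈ (kΔ, (k+1)Δ]`. -/
noncomputable def profileCount {n : ℕ} (x : Fin n → ℂ) (Δ : ℝ) (k : ℕ) : ℕ :=
  Set.ncard {j : Fin n | ‖x j‖ ∈ Set.Ioc ((k : ℝ) * Δ) (((k : ℝ) + 1) * Δ)}

/-- `profileSum x Δ` is the sum over all `k ≥ 1` of `P_k(x, Δ)^2`. -/
noncomputable def profileSum {n : ℕ} (x : Fin n → ℂ) (Δ : ℝ) : ℝ :=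
  ∑' k : ℕ, (profileCount x Δ (k + 1) : ℝ) ^ 2

/-- For `Δ > 0` only finitely many terms of the series defining `profileSum` are nonzero, so the
series converges and its value is the actual sum. -/
theorem summable_profileCount_sq {n : ℕ} (x : Fin n → ℂ) {Δ : ℝ} (hΔ : 0 < Δ) :
    Summable fun k : ℕ => (profileCount x Δ (k + 1) : ℝ) ^ 2 := by
  obtain ⟨K, hK⟩ := exists_nat_gt ((∑ j, ‖x j‖) / Δ)
  rw [div_lt_iff₀ hΔ] at hK
  refine summable_of_ne_finset_zero (s := Finset.range K) fun k hk => ?_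
  have hk' : (K : ℝ) ≤ k := by exact_mod_cast not_lt.mp (mt Finset.mem_range.mpr hk)
  have h0 : profileCount x Δ (k + 1) = 0 := by
    rw [profileCount, Set.ncard_eq_zero]
    refine Set.eq_empty_of_forall_notMem fun j hj => ?_
    have h1 : ‖x j‖ ≤ ∑ j, ‖x j‖ :=
      Finset.single_le_sum (f := fun j => ‖x j‖) (fun i _ => norm_nonneg _) (Finset.mem_univ j)
    have h2 := hj.1
    push_cast at h2
    nlinarith
  simp [h0]

open MeasureTheory ProbabilityTheory Real
open scoped RealInnerProductSpace ComplexConjugate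

/-! Esseen's inequality with Gaussian smoothing (`measureReal_ball_le_integral_charFun`) bounds the
small ball probability by a Gaussian average, at scale `1/Δ`, of the modulus of the characteristic
function. The centre of the ball contributes only a phase, so `u` and `v` play no role.

Symmetrization bounds this modulus by `exp (-(p/2) E g_w)`, where `w = β - β'` for an independent
copy `β'` and `g_w` is the `cosDefect` of `w x`. The event `|w| > r` has positive probability `Q`
for some `r > 0`. Jensen's inequality on that event (`exp_neg_mul_integral_le_cond`) and Fubini
reduce the problem to averaging `exp (-κ g_w)` for one fixed `w`, with `κ = pQ/2`.

This average is a Halász argument (`integral_segment_le`, `integral_gaussian_mul_exp_cosDefect_le`).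
On a short segment either `g` exceeds `n/8` throughout, or it grows quadratically away from its
minimum, which gains `1/√(κn)`, while `∑ cos ≥ n/2` allows multiplication by `(4/n²)(∑ cos)²`. The
Gaussian average of `(∑ cos)²` is a double sum of Gaussians at `x_i ± x_j`. Since `|x_i ± x_j| ≥
||x_i| - |x_j||`, only the moduli matter, and a Schur bound compares the sum with the profile. The
factors `√(κn)` and `n²` produce `(np)^{5/2}`; the remaining `exp (-κn/8)` is absorbed because the
profile sum is bounded below. -/

/-- The quantity `1 - cos` is quasi-subadditive. -/
theorem one_sub_cos_add_le (u v : ℝ) :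
    1 - cos (u + v) ≤ 2 * (1 - cos u) + 2 * (1 - cos v) := by
  have h : ∀ t : ℝ, 1 - cos t = 2 * sin (t / 2) ^ 2 := fun t => by
    have := cos_sq_add_sin_sq (t / 2)
    have h2 := cos_two_mul (t / 2)
    rw [show 2 * (t / 2) = t by ring] at h2
    linarith
  rw [h, h u, h v, add_div, sin_add]
  have h1 := cos_sq_add_sin_sq (u / 2)
  have h2 := cos_sq_add_sin_sq (v / 2)
  nlinarith [sq_nonneg (sin (u / 2) * cos (v / 2) - cos (u / 2) * sin (v / 2)),
    mul_nonneg (sq_nonneg (sin (u / 2))) (sq_nonneg (sin (v / 2)))]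

theorem one_sub_cos_sub_le (u v : ℝ) :
    1 - cos (u - v) ≤ 2 * (1 - cos u) + 2 * (1 - cos v) := by
  simpa [sub_eq_add_neg] using one_sub_cos_add_le u (-v)

/-! ### The cosine defect and its behaviour on short segments. -/

/-- The sum of `1 - cos ⟪x j, s⟫` over all `j`. -/
noncomputable def cosDefect {n : ℕ} (x : Fin n → ℂ) (s : ℂ) : ℝ :=
  ∑ j, (1 - cos ⟪x j, s⟫)

section CosDefect

variable {n : ℕ} (x : Fin n → ℂ)

theorem cosDefect_nonneg (s : ℂ) : 0 ≤ cosDefect x s :=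
  Finset.sum_nonneg fun _ _ => sub_nonneg.2 (cos_le_one _)

@[fun_prop]
theorem continuous_cosDefect : Continuous (cosDefect x) := by
  unfold cosDefect
  fun_prop

theorem sum_cos_eq_sub_cosDefect (s : ℂ) : ∑ j, cos ⟪x j, s⟫ = n - cosDefect x s := by
  simp [cosDefect]

theorem cosDefect_sub_le (s t : ℂ) :
    cosDefect x (s - t) ≤ 2 * cosDefect x s + 2 * cosDefect x t := by
  simp only [cosDefect, Finset.mul_sum, ← Finset.sum_add_distrib, inner_sub_right]
  exact Finset.sum_le_sum fun j _ => one_sub_cos_sub_le _ _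

theorem cosDefect_le_of_norm_le {R : ℝ} (hx : ∀ j, ‖x j‖ ≤ R) (s : ℂ) :
    cosDefect x s ≤ n * (R * ‖s‖) ^ 2 / 2 := by
  have h : ∀ j, 1 - cos ⟪x j, s⟫ ≤ (R * ‖s‖) ^ 2 / 2 := fun j => by
    have h1 := one_sub_sq_div_two_le_cos (x := ⟪x j, s⟫)
    have h2 : |⟪x j, s⟫| ≤ R * ‖s‖ := (abs_real_inner_le_norm _ _).trans (by gcongr; exact hx j)
    have h3 := sq_le_sq' (abs_le.1 h2).1 (abs_le.1 h2).2
    linarith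
  calc cosDefect x s ≤ ∑ _j : Fin n, (R * ‖s‖) ^ 2 / 2 := Finset.sum_le_sum fun j _ => h j
    _ = n * (R * ‖s‖) ^ 2 / 2 := by simp; ring

/-- One of the two coordinate directions carries half of the mass of `x`. -/
theorem exists_direction {a : ℝ} (ha : 0 ≤ a) (hx : ∀ j, a ≤ ‖x j‖) :
    ∃ e : ℂ, ‖e‖ = 1 ∧ n * a ^ 2 / 2 ≤ ∑ j, ⟪x j, e⟫ ^ 2 := by
  have h : (n : ℝ) * a ^ 2 ≤ ∑ j, ⟪x j, (1 : ℂ)⟫ ^ 2 + ∑ j, ⟪x j, Complex.I⟫ ^ 2 := by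
    rw [← Finset.sum_add_distrib]
    calc (n : ℝ) * a ^ 2 = ∑ _j : Fin n, a ^ 2 := by simp
      _ ≤ _ := Finset.sum_le_sum fun j _ => by
        have h1 : ⟪x j, (1 : ℂ)⟫ ^ 2 + ⟪x j, Complex.I⟫ ^ 2 = ‖x j‖ ^ 2 := by
          rw [← Complex.normSq_eq_norm_sq, Complex.normSq_apply]
          simp [Complex.inner]
          ring
        rw [h1]
        exact pow_le_pow_left₀ ha (hx j) 2
  by_cases h1 : n * a ^ 2 / 2 ≤ ∑ j, ⟪x j, (1 : ℂ)⟫ ^ 2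
  · exact ⟨1, by simp, h1⟩
  · exact ⟨Complex.I, by simp, by linarith⟩

/-- On `|θ| ≤ π` one has `1 - cos θ ≥ 2θ²/π²`; the bound on `t` keeps every phase in this range. -/
theorem cosDefect_ge_of_abs_le {R a : ℝ} (hx : ∀ j, ‖x j‖ ≤ R) {e : ℂ} (he : ‖e‖ = 1)
    (hQ : n * a ^ 2 / 2 ≤ ∑ j, ⟪x j, e⟫ ^ 2) {t : ℝ} (ht : R * |t| ≤ π) :
    n * a ^ 2 * t ^ 2 / π ^ 2 ≤ cosDefect x (t • e) := by
  have h : ∀ j, 2 / π ^ 2 * t ^ 2 * ⟪x j, e⟫ ^ 2 ≤ 1 - cos ⟪x j, t • e⟫ := fun j => by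
    have h2 : |⟪x j, t • e⟫| ≤ π := by
      refine (abs_real_inner_le_norm _ _).trans (le_trans ?_ ht)
      rw [norm_smul, he, mul_one, norm_eq_abs]
      gcongr
      exact hx j
    have h3 := Real.cos_le_one_sub_mul_cos_sq h2
    rw [inner_smul_right] at h3 ⊢
    linarith [mul_pow t ⟪x j, e⟫ 2, h3, show 2 / π ^ 2 * t ^ 2 * ⟪x j, e⟫ ^ 2 =
      2 / π ^ 2 * (t * ⟪x j, e⟫) ^ 2 by ring]
  calc n * a ^ 2 * t ^ 2 / π ^ 2 = 2 / π ^ 2 * t ^ 2 * (n * a ^ 2 / 2) := by ring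
    _ ≤ 2 / π ^ 2 * t ^ 2 * ∑ j, ⟪x j, e⟫ ^ 2 := by gcongr
    _ ≤ cosDefect x (t • e) := by
      rw [Finset.mul_sum]
      exact Finset.sum_le_sum fun j _ => h j

/-- The integral of `exp (-κ g)` over a short segment, for `g = cosDefect x`. -/
theorem integral_segment_le {a K κ : ℝ} (ha : 0 < a) (hK : 1 ≤ K) (hκ : 0 < κ)
    (hx : ∀ j, ‖x j‖ ≤ K * a) (hn : 0 < n) {e : ℂ} (he : ‖e‖ = 1)
    (hQ : n * a ^ 2 / 2 ≤ ∑ j, ⟪x j, e⟫ ^ 2) {l : ℝ} (hl : l = 1 / (4 * K * a)) (s : ℂ) :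
    ∫ t in Set.Icc (-l) l, exp (-κ * cosDefect x (s + t • e)) ≤
      2 * π * √π / (a * √(κ * n)) * (4 / n ^ 2) * (∑ j, cos ⟪x j, s⟫) ^ 2
        + 2 * l * exp (-κ * n / 8) := by
  have hK0 : 0 < K := by linarith
  have hl0 : 0 < l := by rw [hl]; positivity
  have hKl : K * a * l = 1 / 4 := by rw [hl]; field_simp
  have hn' : (0 : ℝ) < n := by exact_mod_cast hn
  have hcont : Continuous fun t : ℝ => cosDefect x (s + t • e) := by fun_prop
  by_cases hs : ∃ t ∈ Set.Icc (-l) l, cosDefect x (s + t • e) ≤ n / 8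
  · obtain ⟨t₀, ht₀, hs⟩ := hs
    have hnorm : ‖t₀ • e‖ ≤ l := by
      rw [norm_smul, he, mul_one, norm_eq_abs]
      exact abs_le.2 ht₀
    -- Smallness at one point of the segment passes to `s`: the shift costs at most `n/32`, as `K a
    -- l = 1/4`, so the defect at `s` is at most `n/4 + n/16`.
    have h1 : cosDefect x s ≤ n / 2 := by
      have h2 := cosDefect_sub_le x (s + t₀ • e) (t₀ • e)
      have h3 := cosDefect_le_of_norm_le x hx (t₀ • e)
      have h4 : (K * a * ‖t₀ • e‖) ^ 2 ≤ (1 / 4) ^ 2 := by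
        gcongr
        rw [← hKl]
        gcongr
      have h5 : n * (K * a * ‖t₀ • e‖) ^ 2 / 2 ≤ n * (1 / 4) ^ 2 / 2 := by gcongr
      rw [add_sub_cancel_right] at h2
      linarith
    have h2 : 1 ≤ 4 / n ^ 2 * (∑ j, cos ⟪x j, s⟫) ^ 2 := by
      have h3 : (n : ℝ) / 2 ≤ ∑ j, cos ⟪x j, s⟫ := by
        rw [sum_cos_eq_sub_cosDefect]; linarith
      have h4 : ((n : ℝ) / 2) ^ 2 ≤ (∑ j, cos ⟪x j, s⟫) ^ 2 := by gcongr
      calc (1 : ℝ) = 4 / n ^ 2 * (n / 2) ^ 2 := by field_simp; norm_num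
        _ ≤ _ := by gcongr
    -- At a minimizer `t₁`, quasi-subadditivity gives `g((t - t₁)e) ≤ 4 g(s + te)`, so the quadratic
    -- lower bound at the origin transfers to `t₁` with a loss of 4.
    obtain ⟨t₁, ht₁, hmin⟩ := isCompact_Icc.exists_isMinOn (f := fun t : ℝ => cosDefect x (s + t • e))
      ⟨t₀, ht₀⟩ hcont.continuousOn
    set A : ℝ := κ * (n * a ^ 2 / (4 * π ^ 2)) with hA
    have hA0 : 0 < A := by positivity
    have h3 : ∀ t ∈ Set.Icc (-l) l,
        exp (-κ * cosDefect x (s + t • e)) ≤ exp (-A * (t - t₁) ^ 2) := fun t ht => by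
      have h4 : cosDefect x (s + t₁ • e) ≤ cosDefect x (s + t • e) := hmin ht
      have h5 := cosDefect_sub_le x (s + t • e) (s + t₁ • e)
      rw [add_sub_add_left_eq_sub, ← sub_smul] at h5
      have h6 := cosDefect_ge_of_abs_le x (t := t - t₁) hx he hQ (by
        have : |t - t₁| ≤ 2 * l := by
          rw [abs_le]; constructor <;> linarith [ht.1, ht.2, ht₁.1, ht₁.2]
        calc K * a * |t - t₁| ≤ K * a * (2 * l) := by gcongr
          _ = 1 / 2 := by linarith
          _ ≤ π := by linarith [pi_gt_three])
      have h7 : n * a ^ 2 / (4 * π ^ 2) * (t - t₁) ^ 2 ≤ cosDefect x (s + t • e) := by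
        have : n * a ^ 2 / (4 * π ^ 2) * (t - t₁) ^ 2
          = n * a ^ 2 * (t - t₁) ^ 2 / π ^ 2 / 4 := by field_simp
        linarith
      rw [exp_le_exp, hA]
      have := mul_le_mul_of_nonneg_left h7 hκ.le
      linarith
    have hint : Integrable fun t : ℝ => exp (-A * (t - t₁) ^ 2) :=
      (integrable_exp_neg_mul_sq hA0).comp_sub_right t₁
    have h8 : ∫ t in Set.Icc (-l) l, exp (-κ * cosDefect x (s + t • e)) ≤
        2 * π * √π / (a * √(κ * n)) := by
      calc _ ≤ ∫ t in Set.Icc (-l) l, exp (-A * (t - t₁) ^ 2) :=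
            setIntegral_mono_on (Continuous.integrableOn_Icc (by fun_prop)) hint.integrableOn
              measurableSet_Icc h3
        _ ≤ ∫ t : ℝ, exp (-A * (t - t₁) ^ 2) :=
            setIntegral_le_integral hint (.of_forall fun _ => (exp_pos _).le)
        _ = √(π / A) := by
            rw [integral_sub_right_eq_self (fun t : ℝ => exp (-A * t ^ 2)), integral_gaussian]
        _ = 2 * π * √π / (a * √(κ * n)) := by
            rw [show π / A = π * (2 * π / a) ^ 2 / (κ * n) by rw [hA]; field_simp; ring,
              sqrt_div (by positivity), sqrt_mul pi_pos.le, sqrt_sq (by positivity)]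
            field_simp
    calc _ ≤ 2 * π * √π / (a * √(κ * n)) * 1 := by rw [mul_one]; exact h8
      _ ≤ 2 * π * √π / (a * √(κ * n)) * (4 / n ^ 2 * (∑ j, cos ⟪x j, s⟫) ^ 2) := by gcongr
      _ ≤ _ := by
        rw [← mul_assoc]
        exact le_add_of_nonneg_right (by positivity)
  · push Not at hs
    have h1 : ∫ t in Set.Icc (-l) l, exp (-κ * cosDefect x (s + t • e)) ≤
        ∫ _t in Set.Icc (-l) l, exp (-κ * n / 8) := by
      refine setIntegral_mono_on (Continuous.integrableOn_Icc (by fun_prop))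
        (integrableOn_const (by simp)) measurableSet_Icc fun t ht => ?_
      rw [exp_le_exp]
      have := mul_le_mul_of_nonneg_left (hs t ht).le hκ.le
      linarith
    have h2 : ∫ _t in Set.Icc (-l) l, exp (-κ * n / 8) = 2 * l * exp (-κ * n / 8) := by
      rw [setIntegral_const, Measure.real, Real.volume_Icc, ENNReal.toReal_ofReal (by linarith),
        smul_eq_mul]
      ring
    rw [h2] at h1
    exact h1.trans (le_add_of_nonneg_left (by positivity))

end CosDefect

/-! ### Gaussian integrals over `ℂ` -/

theorem integrable_exp_neg_mul_norm_sq {b : ℝ} (hb : 0 < b) :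
    Integrable fun s : ℂ => exp (-b * ‖s‖ ^ 2) := by
  have h := (GaussianFourier.integrable_cexp_neg_mul_sq_norm_add (V := ℂ) (b := (b : ℂ))
    (by simpa) 0 0).norm
  refine h.congr (.of_forall fun s => ?_)
  simp only [Complex.norm_exp]
  congr 1
  simp [← Complex.ofReal_pow]

theorem integral_exp_neg_mul_norm_sq {b : ℝ} (hb : 0 < b) :
    ∫ s : ℂ, exp (-b * ‖s‖ ^ 2) = π / b := by
  rw [GaussianFourier.integral_rexp_neg_mul_sq_norm hb]
  simp

theorem integral_cexp_inner_mul_gaussian {b : ℝ} (hb : 0 < b) (w : ℂ) :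
    ∫ s : ℂ, (exp (-b * ‖s‖ ^ 2) : ℂ) * Complex.exp (⟪w, s⟫ * Complex.I)
      = ((π / b * exp (-‖w‖ ^ 2 / (4 * b)) : ℝ) : ℂ) := by
  have h := GaussianFourier.integral_cexp_neg_mul_sq_norm_add (V := ℂ) (b := (b : ℂ))
    (by simpa) Complex.I w
  have h2 : (fun s : ℂ => (exp (-b * ‖s‖ ^ 2) : ℂ) * Complex.exp (⟪w, s⟫ * Complex.I))
      = fun v : ℂ => Complex.exp (-b * ‖v‖ ^ 2 + Complex.I * ⟪w, v⟫) := by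
    funext s
    push_cast
    rw [← Complex.exp_add, mul_comm Complex.I]
  rw [h2, h]
  push_cast
  congr 2
  · simp
  · simp

theorem integrable_gaussian_mul_of_bounded {b : ℝ} (hb : 0 < b) {f : ℂ → ℝ}
    (hf : AEStronglyMeasurable f) {M : ℝ} (hM : ∀ s, |f s| ≤ M) :
    Integrable fun s : ℂ => exp (-b * ‖s‖ ^ 2) * f s :=
  (integrable_exp_neg_mul_norm_sq hb).mul_bdd hf (.of_forall hM)

theorem integral_gaussian_mul_cos {b : ℝ} (hb : 0 < b) (w : ℂ) :
    ∫ s : ℂ, exp (-b * ‖s‖ ^ 2) * cos ⟪w, s⟫ = π / b * exp (-‖w‖ ^ 2 / (4 * b)) := by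
  have h := congrArg Complex.re (integral_cexp_inner_mul_gaussian hb w)
  rw [Complex.ofReal_re] at h
  rw [← h, ← RCLike.re_eq_complex_re, ← integral_re]
  · refine integral_congr_ae (.of_forall fun s => ?_)
    simp only [RCLike.re_eq_complex_re, Complex.re_ofReal_mul, Complex.exp_ofReal_mul_I_re]
  · refine (integrable_exp_neg_mul_norm_sq hb).ofReal.mul_bdd (c := 1)
      (by fun_prop) (.of_forall fun s => ?_)
    rw [Complex.norm_exp_ofReal_mul_I]

/-- Product-to-sum formulas reduce the square to Gaussian Fourier transforms at `x i ± x j`; the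
reverse triangle inequality then discards the arguments and keeps the moduli. -/
theorem integral_gaussian_mul_sum_cos_sq_le {n : ℕ} (x : Fin n → ℂ) {b : ℝ} (hb : 0 < b) :
    b / π * ∫ s : ℂ, exp (-b * ‖s‖ ^ 2) * (∑ j, cos ⟪x j, s⟫) ^ 2 ≤
      ∑ i, ∑ j, exp (-(‖x i‖ - ‖x j‖) ^ 2 / (4 * b)) := by
  have hI : ∀ w : ℂ, Integrable fun s : ℂ => exp (-b * ‖s‖ ^ 2) * cos ⟪w, s⟫ := fun w =>
    integrable_gaussian_mul_of_bounded hb (by fun_prop) fun s => abs_cos_le_one _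
  have hI2 : ∀ i j, Integrable fun s : ℂ => (1 / 2) * (exp (-b * ‖s‖ ^ 2) * cos ⟪x i - x j, s⟫
        + exp (-b * ‖s‖ ^ 2) * cos ⟪x i + x j, s⟫) := fun i j => ((hI _).add (hI _)).const_mul _
  have h1 : ∀ s : ℂ, exp (-b * ‖s‖ ^ 2) * (∑ j, cos ⟪x j, s⟫) ^ 2 =
      ∑ i, ∑ j, (1 / 2) * (exp (-b * ‖s‖ ^ 2) * cos ⟪x i - x j, s⟫
        + exp (-b * ‖s‖ ^ 2) * cos ⟪x i + x j, s⟫) := fun s => by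
    rw [sq (∑ j, cos ⟪x j, s⟫), Finset.sum_mul_sum, Finset.mul_sum]
    refine Finset.sum_congr rfl fun i _ => ?_
    rw [Finset.mul_sum]
    refine Finset.sum_congr rfl fun j _ => ?_
    rw [inner_sub_left, inner_add_left, cos_sub, cos_add]
    ring
  simp_rw [h1]
  rw [integral_finsetSum _ fun i _ => integrable_finsetSum _ fun j _ => hI2 i j, Finset.mul_sum]
  refine Finset.sum_le_sum fun i _ => ?_
  rw [integral_finsetSum _ fun j _ => hI2 i j, Finset.mul_sum]
  refine Finset.sum_le_sum fun j _ => ?_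
  rw [integral_const_mul, integral_add (hI _) (hI _), integral_gaussian_mul_cos hb,
    integral_gaussian_mul_cos hb]
  have h2 : ∀ w : ℂ, (‖x i‖ - ‖x j‖) ^ 2 ≤ ‖w‖ ^ 2 →
      exp (-‖w‖ ^ 2 / (4 * b)) ≤ exp (-(‖x i‖ - ‖x j‖) ^ 2 / (4 * b)) := fun w hw => by
    gcongr
  have h3 := h2 (x i - x j) (sq_le_sq.2 (by
    rw [abs_norm]; exact abs_norm_sub_norm_le _ _))
  have h4 := h2 (x i + x j) (sq_le_sq.2 (by
    rw [abs_norm]; simpa using abs_norm_sub_norm_le (x i) (-x j)))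
  calc _ = (exp (-‖x i - x j‖ ^ 2 / (4 * b)) + exp (-‖x i + x j‖ ^ 2 / (4 * b))) / 2 := by
        field_simp
    _ ≤ _ := by linarith

/-! ### Halász's argument: averaging over segments. -/

/-- A Halász-type bound for the Gaussian average of `exp (-κ g)`, where `g = cosDefect x`. -/
theorem integral_gaussian_mul_exp_cosDefect_le {n : ℕ} (x : Fin n → ℂ) {a K κ b : ℝ} (ha : 0 < a)
    (hK : 1 ≤ K) (hκ : 0 < κ) (hb : 0 < b) (hxa : ∀ j, a ≤ ‖x j‖)
    (hx : ∀ j, ‖x j‖ ≤ K * a) (hn : 0 < n) :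
    b / π * ∫ s : ℂ, exp (-b * ‖s‖ ^ 2) * exp (-κ * cosDefect x s) ≤
      exp (b / (16 * a ^ 2)) * (32 * π * √π * K / (√(κ * n) * n ^ 2) *
        ∑ i, ∑ j, exp (-(‖x i‖ - ‖x j‖) ^ 2 / (2 * b)) + 2 * exp (-κ * n / 8)) := by
  obtain ⟨e, he, hQ⟩ := exists_direction x ha.le hxa
  have hK0 : 0 < K := by linarith
  obtain ⟨l, hl⟩ : ∃ l, l = 1 / (4 * K * a) := ⟨_, rfl⟩
  have hl0 : 0 < l := by rw [hl]; positivity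
  have hn' : (0 : ℝ) < n := by exact_mod_cast hn
  have hb2 : 0 < b / 2 := by positivity
  have hle1 : ∀ s, exp (-κ * cosDefect x s) ≤ 1 := fun s => by
    rw [exp_le_one_iff]
    have := mul_nonneg hκ.le (cosDefect_nonneg x s)
    linarith
  have hbl : b * l ^ 2 ≤ b / (16 * a ^ 2) := by
    rw [hl]
    calc b * (1 / (4 * K * a)) ^ 2 = b / (16 * a ^ 2) / K ^ 2 := by field_simp; norm_num
      _ ≤ b / (16 * a ^ 2) := div_le_self (by positivity) (one_le_pow₀ hK)
  set S := ∑ i, ∑ j, exp (-(‖x i‖ - ‖x j‖) ^ 2 / (2 * b)) with hS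
  set J := ∫ s : ℂ, exp (-b * ‖s‖ ^ 2) * exp (-κ * cosDefect x s) with hJ
  -- Translating by `t • e` costs half of the Gaussian exponent and a factor `exp (b l²)`, uniformly
  -- in `t`, so `J` may be averaged over the segment.
  have hshift : ∀ t ∈ Set.Icc (-l) l, J ≤
      exp (b * l ^ 2) * ∫ s : ℂ, exp (-(b / 2) * ‖s‖ ^ 2) * exp (-κ * cosDefect x (s + t • e)) := by
    intro t ht
    rw [hJ, ← integral_add_right_eq_self _ (t • e), ← integral_const_mul]
    refine integral_mono ((integrable_gaussian_mul_of_bounded hb (M := 1)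
      (f := fun s => exp (-κ * cosDefect x s)) (by fun_prop) fun s => ?_).comp_add_right (t • e)) ((integrable_gaussian_mul_of_bounded hb2 (M := 1)
      (by fun_prop) fun s => ?_).const_mul _) fun s => ?_
    · rw [abs_of_pos (exp_pos _)]; exact hle1 _
    · rw [abs_of_pos (exp_pos _)]; exact hle1 _
    · have h1 : ‖s‖ ≤ ‖s + t • e‖ + l := by
        have h2 : ‖t • e‖ ≤ l := by
          rw [norm_smul, he, mul_one, norm_eq_abs]; exact abs_le.2 ht
        have h3 := norm_sub_le (s + t • e) (t • e)
        rw [add_sub_cancel_right] at h3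
        linarith
      have h4 : ‖s‖ ^ 2 ≤ 2 * ‖s + t • e‖ ^ 2 + 2 * l ^ 2 := by
        have h5 : ‖s‖ ^ 2 ≤ (‖s + t • e‖ + l) ^ 2 := by gcongr
        nlinarith [sq_nonneg (‖s + t • e‖ - l)]
      have h6 : exp (-b * ‖s + t • e‖ ^ 2) ≤ exp (b * l ^ 2) * exp (-(b / 2) * ‖s‖ ^ 2) := by
        rw [← exp_add, exp_le_exp]
        linarith [mul_le_mul_of_nonneg_left h4 hb2.le]
      simpa only [mul_assoc] using mul_le_mul_of_nonneg_right h6 (exp_pos _).le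
  have hprod : Integrable (Function.uncurry fun (t : ℝ) (s : ℂ) =>
      exp (-(b / 2) * ‖s‖ ^ 2) * exp (-κ * cosDefect x (s + t • e)))
      ((volume.restrict (Set.Icc (-l) l)).prod volume) := by
    have h1 : Integrable (fun q : ℝ × ℂ => exp (-(b / 2) * ‖q.2‖ ^ 2))
        ((volume.restrict (Set.Icc (-l) l)).prod volume) :=
      (integrable_exp_neg_mul_norm_sq hb2).comp_snd _
    refine h1.mul_bdd (c := 1) (g := fun q : ℝ × ℂ => exp (-κ * cosDefect x (q.2 + q.1 • e)))
      (Continuous.aestronglyMeasurable (by fun_prop)) (.of_forall fun q => ?_)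
    rw [norm_of_nonneg (exp_pos _).le]
    exact hle1 _
  have havg : 2 * l * J ≤ exp (b * l ^ 2) * ∫ s : ℂ, exp (-(b / 2) * ‖s‖ ^ 2) *
      ∫ t in Set.Icc (-l) l, exp (-κ * cosDefect x (s + t • e)) := by
    have h1 : ∫ _t in Set.Icc (-l) l, J = 2 * l * J := by
      rw [setIntegral_const, Measure.real, Real.volume_Icc, ENNReal.toReal_ofReal (by linarith),
        smul_eq_mul]
      ring
    simp_rw [← integral_const_mul (μ := volume.restrict (Set.Icc (-l) l))]
    rw [← h1, ← integral_integral_swap hprod, ← integral_const_mul]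
    exact setIntegral_mono_on (integrableOn_const (by simp))
      (hprod.integral_prod_left.const_mul _) measurableSet_Icc hshift
  set c₁ : ℝ := 2 * π * √π / (a * √(κ * n)) * (4 / n ^ 2) with hc₁
  have hsumI : Integrable fun s : ℂ => exp (-(b / 2) * ‖s‖ ^ 2) * (∑ j, cos ⟪x j, s⟫) ^ 2 := by
    refine integrable_gaussian_mul_of_bounded hb2 (M := (n : ℝ) ^ 2)
      (Continuous.aestronglyMeasurable (by fun_prop)) fun s => ?_
    rw [abs_pow]
    gcongr
    refine (Finset.abs_sum_le_sum_abs _ _).trans ?_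
    calc ∑ j, |cos ⟪x j, s⟫| ≤ ∑ _j : Fin n, (1 : ℝ) :=
          Finset.sum_le_sum fun j _ => abs_cos_le_one _
      _ = n := by simp
  have hseg : ∫ s : ℂ, exp (-(b / 2) * ‖s‖ ^ 2) *
      ∫ t in Set.Icc (-l) l, exp (-κ * cosDefect x (s + t • e)) ≤
      ∫ s : ℂ, (c₁ * (exp (-(b / 2) * ‖s‖ ^ 2) * (∑ j, cos ⟪x j, s⟫) ^ 2) +
        2 * l * exp (-κ * n / 8) * exp (-(b / 2) * ‖s‖ ^ 2)) := by
    refine integral_mono ?_ ((hsumI.const_mul _).add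
      ((integrable_exp_neg_mul_norm_sq hb2).const_mul _)) fun s => ?_
    · simpa only [← integral_const_mul (μ := volume.restrict (Set.Icc (-l) l)),
        Function.uncurry_apply_pair] using hprod.integral_prod_right
    · have h1 := mul_le_mul_of_nonneg_left
        (integral_segment_le x ha hK hκ hx hn he hQ hl s) (exp_pos (-(b / 2) * ‖s‖ ^ 2)).le
      refine h1.trans_eq ?_
      rw [hc₁]
      ring
  rw [integral_add (hsumI.const_mul _) ((integrable_exp_neg_mul_norm_sq hb2).const_mul _),
    integral_const_mul, integral_const_mul, integral_exp_neg_mul_norm_sq hb2] at hseg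
  have hcos := integral_gaussian_mul_sum_cos_sq_le x hb2
  rw [show 4 * (b / 2) = 2 * b by ring, ← hS] at hcos
  set I₂ := ∫ s : ℂ, exp (-(b / 2) * ‖s‖ ^ 2) * (∑ j, cos ⟪x j, s⟫) ^ 2
  have hc₁0 : 0 ≤ c₁ := by positivity
  have hS0 : 0 ≤ S := by positivity
  have h1 : b / π * J ≤ exp (b * l ^ 2) * (b / (2 * l * π)) *
      (c₁ * I₂ + 2 * l * exp (-κ * n / 8) * (π / (b / 2))) := by
    calc b / π * J = b / (2 * l * π) * (2 * l * J) := by field_simp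
      _ ≤ b / (2 * l * π) * (exp (b * l ^ 2) *
          (c₁ * I₂ + 2 * l * exp (-κ * n / 8) * (π / (b / 2)))) := by
        exact mul_le_mul_of_nonneg_left
          (havg.trans (mul_le_mul_of_nonneg_left hseg (exp_pos _).le)) (by positivity)
      _ = _ := by ring
  calc b / π * J ≤ _ := h1
    _ = exp (b * l ^ 2) * (c₁ / l * (b / 2 / π * I₂) + 2 * exp (-κ * n / 8)) := by
      field_simp
    _ ≤ exp (b / (16 * a ^ 2)) * (c₁ / l * S + 2 * exp (-κ * n / 8)) := by gcongr
    _ = _ := by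
      congr 3
      rw [hc₁, hl]
      field_simp
      norm_num

/-! ### Comparison with the profile sum -/

theorem summable_exp_neg_mul_abs_int {ρ : ℝ} (hρ : 0 < ρ) :
    Summable fun d : ℤ => exp (-ρ * |(d : ℝ)|) := by
  have h : Summable fun m : ℕ => exp (-ρ * |((m : ℤ) : ℝ)|) := by
    refine (Real.summable_exp_nat_mul_iff.2 (neg_lt_zero.2 hρ)).congr fun m => ?_
    simp [mul_comm]
  refine Summable.of_nat_of_neg h (h.congr fun m => ?_)
  simp

/-- A Schur-type bound for exponentially decaying kernels on the natural numbers. -/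
theorem sum_sum_exp_neg_mul_abs_sub_le {ρ : ℝ} (hρ : 0 < ρ) (K : ℕ) (w : ℕ → ℝ) :
    ∑ k ∈ Finset.range K, ∑ l ∈ Finset.range K, w k * w l * exp (-ρ * |(k : ℝ) - l|) ≤
      (∑' d : ℤ, exp (-ρ * |(d : ℝ)|)) * ∑ k ∈ Finset.range K, w k ^ 2 := by
  have hrow : ∀ k : ℕ, ∑ l ∈ Finset.range K, exp (-ρ * |(k : ℝ) - l|) ≤
      ∑' d : ℤ, exp (-ρ * |(d : ℝ)|) := fun k => by
    have hinj : Function.Injective fun l : ℕ => (k : ℤ) - l := fun l l' h => by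
      simpa using h
    have h := (summable_exp_neg_mul_abs_int hρ).sum_le_tsum
      ((Finset.range K).map ⟨_, hinj⟩) fun _ _ => (exp_pos _).le
    simpa using h
  have hsymm : ∑ k ∈ Finset.range K, ∑ l ∈ Finset.range K, w l ^ 2 * exp (-ρ * |(k : ℝ) - l|) =
      ∑ k ∈ Finset.range K, ∑ l ∈ Finset.range K, w k ^ 2 * exp (-ρ * |(k : ℝ) - l|) := by
    rw [Finset.sum_comm]
    simp_rw [abs_sub_comm]
  -- AM-GM replaces `w k * w l` by squares; symmetry of the kernel then leaves only its row sums.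
  calc _ ≤ ∑ k ∈ Finset.range K, ∑ l ∈ Finset.range K,
        (w k ^ 2 * exp (-ρ * |(k : ℝ) - l|) + w l ^ 2 * exp (-ρ * |(k : ℝ) - l|)) / 2 := by
        gcongr with k _ l _
        have := mul_le_mul_of_nonneg_right (two_mul_le_add_sq (w k) (w l))
          (exp_pos (-ρ * |(k : ℝ) - l|)).le
        linarith
    _ = ∑ k ∈ Finset.range K, w k ^ 2 * ∑ l ∈ Finset.range K, exp (-ρ * |(k : ℝ) - l|) := by
        simp_rw [← Finset.sum_div, Finset.sum_add_distrib]
        rw [hsymm]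
        simp_rw [Finset.mul_sum]
        ring
    _ ≤ ∑ k ∈ Finset.range K, w k ^ 2 * ∑' d : ℤ, exp (-ρ * |(d : ℝ)|) := by
        gcongr with k _
        exact hrow k
    _ = _ := by rw [Finset.mul_sum]; exact Finset.sum_congr rfl fun _ _ => mul_comm _ _

/-- Rounding the moduli to buckets of width `Δ` changes distances by at most one bucket, hence the
factor `exp ρ`. What remains is a quadratic form in the bucket counts. -/
theorem sum_exp_neg_abs_norm_sub_le_profileSum {n : ℕ} (x : Fin n → ℂ) {Δ ρ : ℝ} (hΔ : 0 < Δ)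
    (hρ : 0 < ρ) (hx : ∀ j, Δ < ‖x j‖) :
    ∑ i, ∑ j, exp (-ρ * (|‖x i‖ - ‖x j‖| / Δ)) ≤
      exp ρ * (∑' d : ℤ, exp (-ρ * |(d : ℝ)|)) * profileSum x Δ := by
  have hbucket : ∀ j, ∃ k : ℕ, ∀ m : ℕ,
      ‖x j‖ ∈ Set.Ioc (((m + 1 : ℕ) : ℝ) * Δ) ((((m + 1 : ℕ) : ℝ) + 1) * Δ) ↔ k = m := fun j => by
    have h1 : 1 < ‖x j‖ / Δ := (one_lt_div hΔ).2 (hx j)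
    have h2 : 1 < ⌈‖x j‖ / Δ⌉₊ := Nat.lt_ceil.2 (by simpa using h1)
    -- Buckets are open on the left and indexed from `k = 1`, so index `m` means ceiling `m + 2`.
    -- The truncated subtraction is harmless because `Δ < ‖x j‖`.
    refine ⟨⌈‖x j‖ / Δ⌉₊ - 2, fun m => ?_⟩
    rw [Set.mem_Ioc, ← lt_div_iff₀ hΔ, ← div_le_iff₀ hΔ, ← Nat.lt_ceil,
      show ((m + 1 : ℕ) : ℝ) + 1 = ((m + 2 : ℕ) : ℝ) by push_cast; ring, ← Nat.ceil_le]
    omega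
  choose f hf using hbucket
  obtain ⟨K, hK⟩ : ∃ K : ℕ, ∀ j, f j < K :=
    ⟨(Finset.univ.sup f) + 1, fun j => Nat.lt_succ_of_le (Finset.le_sup (Finset.mem_univ j))⟩
  have hcount : ∀ k, (profileCount x Δ (k + 1) : ℝ) = (Finset.univ.filter (f · = k)).card := by
    intro k
    rw [profileCount, ← Set.ncard_coe_finset]
    congr 2
    ext j
    simpa using hf j k
  have hfib : ∀ g : ℕ → ℝ, ∑ j, g (f j) =
      ∑ k ∈ Finset.range K, (profileCount x Δ (k + 1) : ℝ) * g k := fun g => by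
    rw [← Finset.sum_fiberwise_of_maps_to' (g := f) (t := Finset.range K)
      fun j _ => Finset.mem_range.2 (hK j)]
    simp [hcount]
  have hpt : ∀ i j, exp (-ρ * (|‖x i‖ - ‖x j‖| / Δ)) ≤
      exp ρ * exp (-ρ * |(f i : ℝ) - f j|) := fun i j => by
    have hi := (hf i (f i)).2 rfl
    have hj := (hf j (f j)).2 rfl
    rw [Set.mem_Ioc, ← lt_div_iff₀ hΔ, ← div_le_iff₀ hΔ] at hi hj
    push_cast at hi hj
    have h1 : |(f i : ℝ) - f j| ≤ |‖x i‖ - ‖x j‖| / Δ + 1 := by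
      rw [show |‖x i‖ - ‖x j‖| / Δ = |‖x i‖ / Δ - ‖x j‖ / Δ| by
        rw [← sub_div, abs_div, abs_of_pos hΔ]]
      have h2 := abs_le.1 (le_refl |‖x i‖ / Δ - ‖x j‖ / Δ|)
      rw [abs_le]
      constructor <;> linarith [hi.1, hi.2, hj.1, hj.2, h2.1, h2.2]
    rw [← exp_add, exp_le_exp]
    linarith [mul_le_mul_of_nonneg_left h1 hρ.le]
  calc _ ≤ ∑ i, ∑ j, exp ρ * exp (-ρ * |(f i : ℝ) - f j|) :=
        Finset.sum_le_sum fun i _ => Finset.sum_le_sum fun j _ => hpt i j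
    _ = exp ρ * ∑ k ∈ Finset.range K, ∑ l ∈ Finset.range K, (profileCount x Δ (k + 1) : ℝ) *
          profileCount x Δ (l + 1) * exp (-ρ * |(k : ℝ) - l|) := by
        simp_rw [← Finset.mul_sum]
        congr 1
        rw [Finset.sum_congr rfl fun i _ => hfib fun l => exp (-ρ * |(f i : ℝ) - l|)]
        rw [hfib fun k => ∑ l ∈ Finset.range K, (profileCount x Δ (l + 1) : ℝ) *
          exp (-ρ * |(k : ℝ) - l|)]
        simp_rw [Finset.mul_sum, mul_assoc]
    _ ≤ exp ρ * ((∑' d : ℤ, exp (-ρ * |(d : ℝ)|)) *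
          ∑ k ∈ Finset.range K, (profileCount x Δ (k + 1) : ℝ) ^ 2) := by
        gcongr
        exact sum_sum_exp_neg_mul_abs_sub_le hρ K fun k => (profileCount x Δ (k + 1) : ℝ)
    _ ≤ exp ρ * ((∑' d : ℤ, exp (-ρ * |(d : ℝ)|)) * profileSum x Δ) := by
        gcongr
        exact (summable_profileCount_sq x hΔ).sum_le_tsum _ fun _ _ => sq_nonneg _
    _ = _ := by ring

/-! ### Characteristic functions -/

theorem Complex.inner_mul_right_eq_inner_conj_mul (w z s : ℂ) :
    ⟪w * z, s⟫ = ⟪w, conj z * s⟫ := by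
  simp only [Complex.inner, map_mul]
  ring_nf

/-- An inequality of Esseen type with Gaussian smoothing. -/
theorem measureReal_ball_le_integral_charFun (μ : Measure ℂ) [IsProbabilityMeasure μ] (z : ℂ)
    {Δ b : ℝ} (hΔ : 0 < Δ) (hb : b = Δ ^ 2 / 4) :
    μ.real (Metric.ball z Δ) ≤
      exp 1 * (b / π * ∫ s : ℂ, exp (-b * ‖s‖ ^ 2) * ‖charFun μ s‖) := by
  have hb0 : 0 < b := by rw [hb]; positivity
  have hint : Integrable (fun y : ℂ => exp (-‖y - z‖ ^ 2 / (4 * b))) μ := by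
    refine Integrable.of_bound (Continuous.aestronglyMeasurable (by fun_prop)) 1
      (.of_forall fun y => ?_)
    rw [norm_of_nonneg (exp_pos _).le, exp_le_one_iff]
    exact div_nonpos_of_nonpos_of_nonneg (by linarith [sq_nonneg ‖y - z‖]) (by positivity)
  -- With `4b = Δ²` the Gaussian is at least `exp (-1)` on the ball.
  have h1 : μ.real (Metric.ball z Δ) ≤ ∫ y, exp 1 * exp (-‖y - z‖ ^ 2 / (4 * b)) ∂μ := by
    rw [← integral_indicator_one Metric.isOpen_ball.measurableSet]
    refine integral_mono ((integrable_const (1 : ℝ)).indicator Metric.isOpen_ball.measurableSet)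
      (hint.const_mul _) fun y => ?_
    by_cases hy : y ∈ Metric.ball z Δ
    · rw [Set.indicator_of_mem hy, Pi.one_apply, ← exp_add, one_le_exp_iff, hb]
      rw [Metric.mem_ball, dist_eq_norm] at hy
      have h2 : ‖y - z‖ ^ 2 / Δ ^ 2 ≤ 1 := (div_le_one (by positivity)).2 (by gcongr)
      rw [show 4 * (Δ ^ 2 / 4) = Δ ^ 2 by ring, neg_div]
      linarith
    · rw [Set.indicator_of_notMem hy]
      positivity
  have hprod : Integrable (Function.uncurry fun (y s : ℂ) =>
      (exp (-b * ‖s‖ ^ 2) : ℂ) * Complex.exp (⟪y - z, s⟫ * Complex.I)) (μ.prod volume) := by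
    have h0 : Integrable fun s : ℂ => (exp (-b * ‖s‖ ^ 2) : ℂ) :=
      (integrable_exp_neg_mul_norm_sq hb0).ofReal
    have h2 : Integrable (fun q : ℂ × ℂ => (exp (-b * ‖q.2‖ ^ 2) : ℂ)) (μ.prod volume) :=
      h0.comp_snd μ
    refine h2.mul_bdd (c := 1) (g := fun q : ℂ × ℂ => Complex.exp (⟪q.1 - z, q.2⟫ * Complex.I))
      (Continuous.aestronglyMeasurable (by fun_prop)) (.of_forall fun q => ?_)
    rw [Complex.norm_exp_ofReal_mul_I]
  have h3 : ((∫ y, exp (-‖y - z‖ ^ 2 / (4 * b)) ∂μ : ℝ) : ℂ) = b / π * ∫ s : ℂ,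
      (exp (-b * ‖s‖ ^ 2) : ℂ) * (Complex.exp (-⟪z, s⟫ * Complex.I) * charFun μ s) := by
    have h4 : ∀ y, ((exp (-‖y - z‖ ^ 2 / (4 * b)) : ℝ) : ℂ) = b / π * ∫ s : ℂ,
        (exp (-b * ‖s‖ ^ 2) : ℂ) * Complex.exp (⟪y - z, s⟫ * Complex.I) := fun y => by
      rw [integral_cexp_inner_mul_gaussian hb0, ← Complex.ofReal_div, ← Complex.ofReal_mul,
        ← mul_assoc, div_mul_div_cancel₀ pi_ne_zero, div_self hb0.ne', one_mul]
    rw [← integral_complex_ofReal]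
    simp_rw [h4]
    rw [integral_const_mul, integral_integral_swap hprod]
    congr 2
    funext s
    rw [charFun_apply, ← integral_const_mul, ← integral_const_mul]
    congr 1
    funext y
    rw [← Complex.exp_add, inner_sub_left]
    push_cast
    congr 2
    ring
  have h5 : ∫ y, exp (-‖y - z‖ ^ 2 / (4 * b)) ∂μ ≤
      b / π * ∫ s : ℂ, exp (-b * ‖s‖ ^ 2) * ‖charFun μ s‖ := by
    have h6 := congrArg norm h3
    rw [Complex.norm_real, norm_of_nonneg (integral_nonneg fun _ => (exp_pos _).le), norm_mul,
      ← Complex.ofReal_div, Complex.norm_real, norm_of_nonneg (by positivity)] at h6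
    rw [h6]
    gcongr
    -- The centre `z` appears only in a unimodular factor and disappears here.
    refine (norm_integral_le_integral_norm _).trans_eq ?_
    congr 1
    funext s
    rw [norm_mul, norm_mul, Complex.norm_real, norm_of_nonneg (exp_pos _).le,
      ← Complex.ofReal_neg, Complex.norm_exp_ofReal_mul_I, one_mul]
  rw [integral_const_mul] at h1
  exact h1.trans (by gcongr)

/-- Symmetrization: `|φ|²` is the characteristic function of the difference of two independent
copies. -/
theorem one_sub_norm_charFun_sq (ν : Measure ℂ) [IsProbabilityMeasure ν] (t : ℂ) :
    1 - ‖charFun ν t‖ ^ 2 = ∫ q : ℂ × ℂ, (1 - cos ⟪q.1 - q.2, t⟫) ∂(ν.prod ν) := by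
  have hcos : Integrable (fun q : ℂ × ℂ => cos ⟪q.1 - q.2, t⟫) (ν.prod ν) :=
    Integrable.of_bound (Continuous.aestronglyMeasurable (by fun_prop)) 1
      (.of_forall fun q => abs_cos_le_one _)
  have hexp : Integrable (fun q : ℂ × ℂ => Complex.exp (⟪q.1 - q.2, t⟫ * Complex.I)) (ν.prod ν) :=
    Integrable.of_bound (Continuous.aestronglyMeasurable (by fun_prop)) 1
      (.of_forall fun q => by rw [Complex.norm_exp_ofReal_mul_I])
  rw [integral_sub (integrable_const _) hcos]
  simp only [integral_const, probReal_univ, smul_eq_mul, mul_one, sub_right_inj]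
  have h1 : charFun ν t * charFun ν (-t) =
      ∫ q : ℂ × ℂ, Complex.exp (⟪q.1 - q.2, t⟫ * Complex.I) ∂(ν.prod ν) := by
    rw [charFun_apply, charFun_apply, ← integral_prod_mul]
    congr 1
    funext q
    rw [← Complex.exp_add, inner_sub_left, inner_neg_right]
    push_cast
    ring_nf
  rw [charFun_neg, Complex.mul_conj, Complex.normSq_eq_norm_sq] at h1
  have h2 := congrArg Complex.re h1
  rw [Complex.ofReal_re, ← RCLike.re_eq_complex_re, ← integral_re hexp] at h2
  rw [h2]
  simp only [RCLike.re_eq_complex_re, Complex.exp_ofReal_mul_I_re]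

/-- After `1 + y ≤ exp y`, the remaining difference is `(p/2)(1 - t)²`. -/
theorem one_sub_add_mul_le_exp {p t : ℝ} (hp : 0 ≤ p) :
    1 - p + p * t ≤ exp (-(p / 2) * (1 - t ^ 2)) := by
  have h := add_one_le_exp (-(p / 2) * (1 - t ^ 2))
  nlinarith [mul_nonneg hp (sq_nonneg (1 - t))]

theorem integral_eq_of_bernoulli {μ : Measure ℝ} [IsProbabilityMeasure μ] {p : ℝ}
    (h1 : μ.real {1} = p) (h0 : μ.real {0} = 1 - p) (H : ℝ → ℂ) :
    ∫ e, H e ∂μ = (1 - p) * H 0 + p * H 1 := by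
  have hdisj : Disjoint ({0} : Set ℝ) {1} := by simp
  have hfull : ∀ᵐ e ∂μ, e ∈ ({0} ∪ {1} : Set ℝ) := by
    change ({0} ∪ {1} : Set ℝ) ∈ ae μ
    rw [mem_ae_iff_prob_eq_one (by measurability), ← ENNReal.toReal_eq_one_iff]
    change μ.real _ = 1
    rw [measureReal_union hdisj (measurableSet_singleton _), h0, h1]
    ring
  have hH : H =ᵐ[μ] fun e => ({0} : Set ℝ).indicator (fun _ => H 0) e +
      ({1} : Set ℝ).indicator (fun _ => H 1) e := by
    filter_upwards [hfull] with e he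
    rcases he with rfl | rfl <;> simp
  rw [integral_congr_ae hH, integral_add
    ((integrable_const _).indicator (measurableSet_singleton _))
    ((integrable_const _).indicator (measurableSet_singleton _)),
    integral_indicator_const _ (measurableSet_singleton _),
    integral_indicator_const _ (measurableSet_singleton _), h0, h1]
  simp

section RandomSum

variable {Ω : Type*} [MeasurableSpace Ω] {P : Measure Ω} [IsProbabilityMeasure P] {n : ℕ} {p : ℝ}
  {b : Fin n → Ω → ℂ} {ε : Fin n → Ω → ℝ} {ν : Measure ℂ} [IsProbabilityMeasure ν]

theorem charFun_sum_bernoulli_mul (hb : ∀ j, AEMeasurable (b j) P) (hbν : ∀ j, P.map (b j) = ν)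
    (hbi : iIndepFun b P) (hε : ∀ j, AEMeasurable (ε j) P)
    (h1 : ∀ j, P.real {ω | ε j ω = 1} = p) (h0 : ∀ j, P.real {ω | ε j ω = 0} = 1 - p)
    (hεi : iIndepFun ε P) (hεb : IndepFun (fun ω j => ε j ω) (fun ω j => b j ω) P)
    (x : Fin n → ℂ) (s : ℂ) :
    charFun (P.map fun ω => ∑ j, (ε j ω : ℂ) * b j ω * x j) s =
      ∏ j, ((1 - p) + p * charFun ν (conj (x j) * s)) := by
  have hεm : AEMeasurable (fun ω j => ε j ω) P := aemeasurable_pi_lambda _ hε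
  have hbm : AEMeasurable (fun ω j => b j ω) P := aemeasurable_pi_lambda _ hb
  have : ∀ j, IsProbabilityMeasure (P.map (ε j)) := fun j => Measure.isProbabilityMeasure_map (hε j)
  have hlaw : P.map (fun ω => ((fun j => ε j ω), fun j => b j ω)) =
      (Measure.pi fun j => P.map (ε j)).prod (Measure.pi fun _ => ν) := by
    rw [hεb.map_prod_eq_prod_map_map hεm hbm, hεi.map_fun_eq_pi_map hε, hbi.map_fun_eq_pi_map hb]
    simp_rw [hbν]
  have hcont : Continuous fun q : (Fin n → ℝ) × (Fin n → ℂ) =>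
      ∏ j, Complex.exp (⟪(q.1 j : ℂ) * q.2 j * x j, s⟫ * Complex.I) := by
    refine continuous_finsetProd _ fun j _ => ?_
    have h2 : Continuous fun q : (Fin n → ℝ) × (Fin n → ℂ) => (q.1 j : ℂ) :=
      Complex.continuous_ofReal.comp ((continuous_apply j).comp continuous_fst)
    fun_prop
  have hXm : AEMeasurable (fun ω => ∑ j, (ε j ω : ℂ) * b j ω * x j) P := by
    refine Finset.aemeasurable_fun_sum _ fun j _ => ?_
    exact ((Complex.measurable_ofReal.comp_aemeasurable (hε j)).mul (hb j)).mul_const _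
  rw [charFun_apply, integral_map hXm (Continuous.aestronglyMeasurable (by fun_prop))]
  have h3 : ∀ ω, Complex.exp (⟪∑ j, (ε j ω : ℂ) * b j ω * x j, s⟫ * Complex.I) =
      ∏ j, Complex.exp (⟪(ε j ω : ℂ) * b j ω * x j, s⟫ * Complex.I) := fun ω => by
    rw [← Complex.exp_sum, sum_inner, Complex.ofReal_sum, Finset.sum_mul]
  simp_rw [h3]
  rw [← integral_map (φ := fun ω => ((fun j => ε j ω), fun j => b j ω)) (hεm.prodMk hbm)
    (f := fun q : (Fin n → ℝ) × (Fin n → ℂ) =>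
      ∏ j, Complex.exp (⟪(q.1 j : ℂ) * q.2 j * x j, s⟫ * Complex.I)) hcont.aestronglyMeasurable,
    hlaw, integral_prod _ (Integrable.of_bound hcont.aestronglyMeasurable 1
      (.of_forall fun q => by
        simp only [norm_prod, Complex.norm_exp_ofReal_mul_I, Finset.prod_const_one, le_refl]))]
  have h4 : ∀ e : Fin n → ℝ, ∫ y : Fin n → ℂ,
      ∏ j, Complex.exp (⟪(e j : ℂ) * y j * x j, s⟫ * Complex.I) ∂(Measure.pi fun _ => ν) =
      ∏ j, ∫ y, Complex.exp (⟪(e j : ℂ) * y * x j, s⟫ * Complex.I) ∂ν := fun e =>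
    integral_fintype_prod_eq_prod fun j (y : ℂ) =>
      Complex.exp (⟪(e j : ℂ) * y * x j, s⟫ * Complex.I)
  simp_rw [h4]
  rw [integral_fintype_prod_eq_prod (μ := fun j => P.map (ε j))
    (fun j (e : ℝ) => ∫ y, Complex.exp (⟪(e : ℂ) * y * x j, s⟫ * Complex.I) ∂ν)]
  refine Finset.prod_congr rfl fun j _ => ?_
  rw [integral_eq_of_bernoulli (p := p)]
  · simp_rw [charFun_apply, ← Complex.inner_mul_right_eq_inner_conj_mul]
    simp only [Complex.ofReal_zero, Complex.ofReal_one, zero_mul, one_mul, inner_zero_left,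
      Complex.exp_zero, integral_const, probReal_univ, one_smul, mul_one]
  · rw [map_measureReal_apply_of_aemeasurable (hε j) (measurableSet_singleton _)]
    exact h1 j
  · rw [map_measureReal_apply_of_aemeasurable (hε j) (measurableSet_singleton _)]
    exact h0 j

end RandomSum

/-! ### Symmetrization and conditioning on a nondegenerate difference. -/

theorem integrable_cosDefect_mul {n : ℕ} (m : Measure (ℂ × ℂ)) [IsFiniteMeasure m]
    (x : Fin n → ℂ) (s : ℂ) :
    Integrable (fun q : ℂ × ℂ => cosDefect (fun j => (q.1 - q.2) * x j) s) m := by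
  unfold cosDefect
  refine integrable_finsetSum _ fun j _ => (integrable_const _).sub ?_
  exact Integrable.of_bound (Continuous.aestronglyMeasurable (by fun_prop)) 1
      (.of_forall fun q => abs_cos_le_one _)

theorem prod_charFun_le_exp_integral {n : ℕ} (ν : Measure ℂ) [IsProbabilityMeasure ν] {p : ℝ}
    (hp : 0 ≤ p) (hp1 : p ≤ 1) (x : Fin n → ℂ) (s : ℂ) :
    ‖∏ j, ((1 - p) + p * charFun ν (conj (x j) * s) : ℂ)‖ ≤
      exp (-(p / 2) * ∫ q : ℂ × ℂ, cosDefect (fun j => (q.1 - q.2) * x j) s ∂(ν.prod ν)) := by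
  have hI : ∀ j, Integrable (fun q : ℂ × ℂ => 1 - cos ⟪(q.1 - q.2) * x j, s⟫) (ν.prod ν) := fun j =>
    (integrable_const _).sub <| Integrable.of_bound (Continuous.aestronglyMeasurable (by fun_prop))
      1 (.of_forall fun q => abs_cos_le_one _)
  unfold cosDefect
  rw [integral_finsetSum _ fun j _ => hI j, Finset.mul_sum, exp_sum, norm_prod]
  refine Finset.prod_le_prod (fun _ _ => norm_nonneg _) fun j _ => ?_
  simp_rw [Complex.inner_mul_right_eq_inner_conj_mul]
  rw [← one_sub_norm_charFun_sq]
  refine le_trans ?_ (one_sub_add_mul_le_exp hp)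
  refine (norm_add_le _ _).trans_eq ?_
  rw [norm_mul, ← Complex.ofReal_one, ← Complex.ofReal_sub, Complex.norm_real, Complex.norm_real,
    norm_of_nonneg hp, norm_of_nonneg (sub_nonneg.2 hp1)]

/-- Dropping the complement of `A` bounds the mean of `G` below by `m.real A` times its conditional
mean; Jensen then moves the exponential inside. -/
theorem exp_neg_mul_integral_le_cond {α : Type*} [MeasurableSpace α] (m : Measure α)
    [IsProbabilityMeasure m] {A : Set α} (hA : m.real A ≠ 0) {G : α → ℝ}
    (hG : Integrable G m) (hG0 : ∀ q, 0 ≤ G q) {κ : ℝ} (hκ : 0 ≤ κ) :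
    exp (-κ * ∫ q, G q ∂m) ≤ ∫ q, exp (-(κ * m.real A) * G q) ∂(m[|A]) := by
  have hA' : m A ≠ 0 := fun h => hA (by simp [Measure.real, h])
  have := cond_isProbabilityMeasure hA'
  have hGc : Integrable G (m[|A]) := by
    rw [ProbabilityTheory.cond]
    exact hG.integrableOn.smul_measure (by simp [hA'])
  have h1 : m.real A * ∫ q, G q ∂(m[|A]) ≤ ∫ q, G q ∂m := by
    rw [ProbabilityTheory.cond, integral_smul_measure, ENNReal.toReal_inv, smul_eq_mul, ← mul_assoc]
    change m.real A * (m.real A)⁻¹ * _ ≤ _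
    rw [mul_inv_cancel₀ hA, one_mul]
    exact setIntegral_le_integral hG (.of_forall hG0)
  have hqκ : 0 ≤ κ * m.real A := by positivity
  have h2 : exp (∫ q, -(κ * m.real A) * G q ∂(m[|A])) ≤
      ∫ q, exp (-(κ * m.real A) * G q) ∂(m[|A]) := by
    refine convexOn_exp.map_integral_le continuous_exp.continuousOn isClosed_univ (by simp)
      (hGc.const_mul _) ?_
    refine Integrable.of_bound
      (continuous_exp.comp_aestronglyMeasurable (hGc.const_mul _).aestronglyMeasurable) 1
      (.of_forall fun q => ?_)
    rw [Function.comp_apply, norm_of_nonneg (exp_pos _).le, exp_le_one_iff]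
    linarith [mul_nonneg hqκ (hG0 q)]
  refine le_trans ?_ h2
  rw [integral_const_mul, exp_le_exp]
  linarith [mul_le_mul_of_nonneg_left h1 hκ]

/-- A centered nontrivial distribution charges `{|y - y'| > r}` for some `r > 0`. -/
theorem exists_pos_measure_norm_sub (ν : Measure ℂ) [IsProbabilityMeasure ν]
    (hmean : ∫ y, y ∂ν = 0) {c : ℝ} (hc : 0 < c)
    (hν : 0 < ν.real {y : ℂ | c < ‖y‖}) :
    ∃ r : ℝ, 0 < r ∧ (ν.prod ν).real {q : ℂ × ℂ | r < ‖q.1 - q.2‖} ≠ 0 := by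
  by_contra! hcon
  have h1 : ∀ᵐ q ∂(ν.prod ν), q.1 = q.2 := by
    have h2 : ∀ k : ℕ, ∀ᵐ q ∂(ν.prod ν), ‖q.1 - q.2‖ ≤ 1 / ((k : ℝ) + 1) := fun k => by
      have h3 := hcon (1 / ((k : ℝ) + 1)) (by positivity)
      rw [measureReal_eq_zero_iff] at h3
      rw [ae_iff]
      simpa only [not_le] using h3
    filter_upwards [ae_all_iff.2 h2] with q hq
    have h4 : ‖q.1 - q.2‖ ≤ 0 := ge_of_tendsto' tendsto_one_div_add_atTop_nhds_zero_nat hq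
    exact sub_eq_zero.1 (norm_le_zero_iff.1 h4)
  -- If two independent copies agree almost surely, the law is a point mass, necessarily at its mean
  -- `0`.
  have h5 : ∀ᵐ y ∂ν, y = 0 := by
    filter_upwards [Measure.ae_ae_of_ae_prod h1] with y hy
    have h6 : ∫ y', y' ∂ν = ∫ _y', y ∂ν :=
      integral_congr_ae (hy.mono fun y' h => h.symm)
    simpa [hmean, eq_comm] using h6
  have h7 : ν.real {y : ℂ | c < ‖y‖} = 0 := by
    have h8 : ∀ᵐ y ∂ν, ¬ c < ‖y‖ := h5.mono fun y hy => by simp [hy, hc.le]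
    rw [measureReal_eq_zero_iff]
    simpa only [ae_iff, not_not] using h8
  exact hν.ne' h7

/-! ### Powers of `np`, and assembly of the estimates. -/

theorem exp_neg_mul_le_div_rpow_five_halves {c y : ℝ} (hc : 0 < c) (hy : 0 < y) :
    exp (-(c * y)) ≤ (1 + 6 / c ^ 3) / y ^ (5 / 2 : ℝ) := by
  have h1 : y ^ (5 / 2 : ℝ) ≤ 1 + y ^ 3 := by
    rcases le_total y 1 with h | h
    · have := rpow_le_one hy.le h (by norm_num : (0 : ℝ) ≤ 5 / 2)
      have := pow_pos hy 3
      linarith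
    · calc y ^ (5 / 2 : ℝ) ≤ y ^ ((3 : ℕ) : ℝ) :=
            rpow_le_rpow_of_exponent_le h (by norm_num)
        _ = y ^ 3 := rpow_natCast y 3
        _ ≤ 1 + y ^ 3 := by linarith
  have h4 : (c * y) ^ 3 / 6 ≤ exp (c * y) := by
    have := pow_div_factorial_le_exp (c * y) (by positivity) 3
    norm_num [Nat.factorial] at this
    exact this
  have h5 : y ^ 3 * exp (-(c * y)) ≤ 6 / c ^ 3 := by
    rw [exp_neg, ← div_eq_mul_inv, div_le_iff₀ (exp_pos _)]
    calc y ^ 3 = 6 / c ^ 3 * ((c * y) ^ 3 / 6) := by field_simp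
      _ ≤ _ := by gcongr
  rw [le_div_iff₀ (rpow_pos_of_pos hy _)]
  calc exp (-(c * y)) * y ^ (5 / 2 : ℝ) ≤ exp (-(c * y)) * (1 + y ^ 3) := by gcongr
    _ = exp (-(c * y)) + y ^ 3 * exp (-(c * y)) := by ring
    _ ≤ 1 + 6 / c ^ 3 := by
      gcongr
      exact exp_le_one_iff.2 (by linarith [mul_pos hc hy])

/-- The Halász bound yields `√(np) n²`; weakening `n²` to `(np)²` gives the exponent `5/2`. -/
theorem one_div_sqrt_mul_sq_le {c p : ℝ} {n : ℕ} (hc : 0 < c) (hp : 0 < p) (hp1 : p ≤ 1)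
    (hn : 0 < n) :
    1 / (√(c * p * n) * n ^ 2) ≤ 1 / √c / ((n : ℝ) * p) ^ (5 / 2 : ℝ) := by
  have hn' : (0 : ℝ) < n := by exact_mod_cast hn
  have h1 : ((n : ℝ) * p) ^ (5 / 2 : ℝ) = √(n * p) * (n * p) ^ 2 := by
    rw [sqrt_eq_rpow, ← rpow_natCast, ← rpow_add (by positivity)]
    norm_num
  rw [h1, div_div, show c * p * n = c * (n * p) by ring, sqrt_mul hc.le, mul_assoc]
  gcongr
  exact mul_le_of_le_one_right hn'.le hp1

/-- The averaged bound for a fixed value `w` of the symmetrized coefficient. -/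
theorem integral_gaussian_mul_exp_cosDefect_mul_le {n : ℕ} (x : Fin n → ℂ) {a K κ Δ r : ℝ}
    (ha : 0 < a) (hK : 1 ≤ K) (hκ : 0 < κ) (hΔ : 0 < Δ) (hΔa : Δ ≤ a) (hr : 0 < r)
    (hxa : ∀ j, a < ‖x j‖) (hx : ∀ j, ‖x j‖ ≤ K * a) (hn : 0 < n) {w : ℂ} (hw : r < ‖w‖) :
    ∫ s : ℂ, exp (-(Δ ^ 2 / 4) * ‖s‖ ^ 2) * exp (-κ * cosDefect (fun j => w * x j) s) ≤
      π / (Δ ^ 2 / 4) * (exp (1 / r ^ 2) * (32 * π * √π * K / (√(κ * n) * n ^ 2) *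
        (exp (2 * r ^ 2 + 4 * r ^ 2) * (∑' d : ℤ, exp (-(4 * r ^ 2) * |(d : ℝ)|)) *
          profileSum x Δ) + 2 * exp (-κ * n / 8))) := by
  have hw0 : 0 < ‖w‖ := hr.trans hw
  have h := integral_gaussian_mul_exp_cosDefect_le (fun j => w * x j) (a := ‖w‖ * a) (K := K)
    (b := Δ ^ 2 / 4) (by positivity) hK hκ (by positivity)
    (fun j => by rw [norm_mul]; gcongr; exact (hxa j).le)
    (fun j => by
      rw [norm_mul, mul_left_comm]; gcongr; exact hx j) hn
  have hexp : Δ ^ 2 / 4 / (16 * (‖w‖ * a) ^ 2) ≤ 1 / r ^ 2 := by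
    calc Δ ^ 2 / 4 / (16 * (‖w‖ * a) ^ 2) ≤ a ^ 2 / 4 / (16 * (r * a) ^ 2) := by gcongr
      _ = 1 / 64 * (1 / r ^ 2) := by field_simp; norm_num
      _ ≤ 1 / r ^ 2 := by
        have : 0 ≤ 1 / r ^ 2 := by positivity
        linarith
  have hS : ∑ i, ∑ j, exp (-(‖w * x i‖ - ‖w * x j‖) ^ 2 / (2 * (Δ ^ 2 / 4))) ≤
      exp (2 * r ^ 2 + 4 * r ^ 2) * (∑' d : ℤ, exp (-(4 * r ^ 2) * |(d : ℝ)|)) *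
        profileSum x Δ := by
    have h2 := sum_exp_neg_abs_norm_sub_le_profileSum x (Δ := Δ) (ρ := 4 * r ^ 2) hΔ
      (by positivity) fun j => hΔa.trans_lt (hxa j)
    have h3 : ∀ i j, exp (-(‖w * x i‖ - ‖w * x j‖) ^ 2 / (2 * (Δ ^ 2 / 4))) ≤
        exp (2 * r ^ 2) * exp (-(4 * r ^ 2) * (|‖x i‖ - ‖x j‖| / Δ)) := fun i j => by
      rw [← exp_add, exp_le_exp, norm_mul, norm_mul, ← mul_sub, mul_pow, ← sq_abs (‖x i‖ - ‖x j‖)]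
      set T := |‖x i‖ - ‖x j‖| / Δ with hT
      have h4 : -(‖w‖ ^ 2 * |‖x i‖ - ‖x j‖| ^ 2) / (2 * (Δ ^ 2 / 4)) = -(2 * (‖w‖ ^ 2 * T ^ 2)) := by
        rw [hT]
        field_simp
        norm_num
      have h5 : r ^ 2 * T ^ 2 ≤ ‖w‖ ^ 2 * T ^ 2 := by gcongr
      rw [h4]
      -- `2r²T² ≥ 4r²T - 2r²` turns Gaussian decay into exponential decay; this is the source of the
      -- rate `4r²` and the factor `exp (2r²)`.
      nlinarith [mul_nonneg (sq_nonneg r) (sq_nonneg (T - 1))]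
    calc _ ≤ ∑ i, ∑ j, exp (2 * r ^ 2) * exp (-(4 * r ^ 2) * (|‖x i‖ - ‖x j‖| / Δ)) :=
          Finset.sum_le_sum fun i _ => Finset.sum_le_sum fun j _ => h3 i j
      _ = exp (2 * r ^ 2) * ∑ i, ∑ j, exp (-(4 * r ^ 2) * (|‖x i‖ - ‖x j‖| / Δ)) := by
          simp_rw [Finset.mul_sum]
      _ ≤ _ := mul_le_mul_of_nonneg_left h2 (exp_pos _).le
      _ = _ := by rw [exp_add]; ring
  calc _ = π / (Δ ^ 2 / 4) * (Δ ^ 2 / 4 / π * ∫ s : ℂ, exp (-(Δ ^ 2 / 4) * ‖s‖ ^ 2) *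
        exp (-κ * cosDefect (fun j => w * x j) s)) := by
        rw [← mul_assoc, div_mul_div_cancel₀ (by positivity), div_self pi_ne_zero, one_mul]
    _ ≤ _ := by
        refine mul_le_mul_of_nonneg_left (h.trans ?_) (by positivity)
        gcongr

theorem integral_gaussian_mul_le_of_le_integral {n : ℕ} (m : Measure (ℂ × ℂ))
    [IsProbabilityMeasure m] (x : Fin n → ℂ) {b κ M : ℝ} (hb : 0 < b) (hκ : 0 ≤ κ) {f : ℂ → ℝ}
    (hf0 : ∀ s, 0 ≤ f s)
    (hf : ∀ s, f s ≤ ∫ q : ℂ × ℂ, exp (-κ * cosDefect (fun j => (q.1 - q.2) * x j) s) ∂m)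
    (hM : ∀ᵐ q ∂m, ∫ s : ℂ, exp (-b * ‖s‖ ^ 2) *
      exp (-κ * cosDefect (fun j => (q.1 - q.2) * x j) s) ≤ M) :
    ∫ s : ℂ, exp (-b * ‖s‖ ^ 2) * f s ≤ M := by
  have hcontG : Continuous fun z : ℂ × (ℂ × ℂ) =>
      exp (-κ * cosDefect (fun j => (z.2.1 - z.2.2) * x j) z.1) := by
    unfold cosDefect
    fun_prop
  have hprod : Integrable (Function.uncurry fun (s : ℂ) (q : ℂ × ℂ) =>
      exp (-b * ‖s‖ ^ 2) * exp (-κ * cosDefect (fun j => (q.1 - q.2) * x j) s))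
      (volume.prod m) := by
    have h1 : Integrable (fun z : ℂ × (ℂ × ℂ) => exp (-b * ‖z.1‖ ^ 2)) (volume.prod m) :=
      (integrable_exp_neg_mul_norm_sq hb).comp_fst m
    refine h1.mul_bdd (c := 1) hcontG.aestronglyMeasurable (.of_forall fun z => ?_)
    rw [norm_of_nonneg (exp_pos _).le, exp_le_one_iff]
    have := mul_nonneg hκ (cosDefect_nonneg (fun j => (z.2.1 - z.2.2) * x j) z.1)
    linarith
  calc _ ≤ ∫ s : ℂ, ∫ q : ℂ × ℂ, exp (-b * ‖s‖ ^ 2) *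
        exp (-κ * cosDefect (fun j => (q.1 - q.2) * x j) s) ∂m := by
        refine integral_mono_of_nonneg
          (.of_forall fun s => mul_nonneg (exp_pos _).le (hf0 s))
          hprod.integral_prod_left (.of_forall fun s => ?_)
        simp only
        rw [integral_const_mul]
        exact mul_le_mul_of_nonneg_left (hf s) (exp_pos _).le
    _ = ∫ q : ℂ × ℂ, (∫ s : ℂ, exp (-b * ‖s‖ ^ 2) *
        exp (-κ * cosDefect (fun j => (q.1 - q.2) * x j) s)) ∂m :=
        integral_integral_swap hprod
    _ ≤ ∫ _q : ℂ × ℂ, M ∂m :=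
        integral_mono_ae hprod.integral_prod_right (integrable_const _) hM
    _ = M := by simp

theorem integral_gaussian_mul_norm_prod_charFun_le {n : ℕ} (x : Fin n → ℂ) {a K p Δ r : ℝ}
    (ν : Measure ℂ) [IsProbabilityMeasure ν] (hp : 0 < p) (hp1 : p ≤ 1)
    (ha : 0 < a) (hK : 1 ≤ K) (hΔ : 0 < Δ) (hΔa : Δ ≤ a) (hr : 0 < r)
    (hq : (ν.prod ν).real {q : ℂ × ℂ | r < ‖q.1 - q.2‖} ≠ 0)
    (hxa : ∀ j, a < ‖x j‖) (hx : ∀ j, ‖x j‖ ≤ K * a) (hn : 0 < n) {κ : ℝ}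
    (hκ : κ = p / 2 * (ν.prod ν).real {q : ℂ × ℂ | r < ‖q.1 - q.2‖}) :
    ∫ s : ℂ, exp (-(Δ ^ 2 / 4) * ‖s‖ ^ 2) * ‖∏ j, ((1 - p) + p * charFun ν (conj (x j) * s) : ℂ)‖ ≤
      π / (Δ ^ 2 / 4) * (exp (1 / r ^ 2) * (32 * π * √π * K / (√(κ * n) * n ^ 2) *
        (exp (2 * r ^ 2 + 4 * r ^ 2) * (∑' d : ℤ, exp (-(4 * r ^ 2) * |(d : ℝ)|)) *
          profileSum x Δ) + 2 * exp (-κ * n / 8))) := by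
  set A : Set (ℂ × ℂ) := {q : ℂ × ℂ | r < ‖q.1 - q.2‖} with hA
  have hAm : MeasurableSet A := measurableSet_lt (by fun_prop) (by fun_prop)
  have hA0 : (ν.prod ν) A ≠ 0 := fun h => hq (by simp [Measure.real, h])
  have hκ0 : 0 < κ := by
    rw [hκ]
    have : 0 < (ν.prod ν).real A := lt_of_le_of_ne measureReal_nonneg (Ne.symm hq)
    positivity
  have := cond_isProbabilityMeasure hA0
  have hpt : ∀ s : ℂ, ‖∏ j, ((1 - p) + p * charFun ν (conj (x j) * s) : ℂ)‖ ≤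
      ∫ q : ℂ × ℂ, exp (-κ * cosDefect (fun j => (q.1 - q.2) * x j) s) ∂((ν.prod ν)[|A]) := by
    intro s
    refine (prod_charFun_le_exp_integral ν hp.le hp1 x s).trans ?_
    rw [hκ]
    exact exp_neg_mul_integral_le_cond (ν.prod ν) hq (integrable_cosDefect_mul _ x s)
      (fun q => cosDefect_nonneg _ _) (by positivity)
  refine integral_gaussian_mul_le_of_le_integral _ x (by positivity) hκ0.le
    (fun s => norm_nonneg _) hpt ?_
  filter_upwards [ae_cond_mem hAm] with q hqA
  exact integral_gaussian_mul_exp_cosDefect_mul_le x ha hK hκ0 hΔ hΔa hr hxa hx hn hqA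

theorem mainTheorem6
    -- the complex random variable `β`: centered, with `Pr(|β| > c) ≥ c'`
    {Ω₀ : Type*} [MeasurableSpace Ω₀] (P₀ : MeasureTheory.Measure Ω₀)
    [MeasureTheory.IsProbabilityMeasure P₀]
    (β : Ω₀ → ℂ) (hβ_int : MeasureTheory.Integrable β P₀)
    (hβ_mean : ∫ ω, β ω ∂P₀ = 0)
    (c c' : ℝ) (hc : 0 < c) (hc' : 0 < c')
    (hβ_nondeg : c' ≤ P₀.real {ω | c < ‖β ω‖})
    -- the constant bounding the ratio of the moduli of the coordinates
    (Cbar : ℝ) :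
    ∃ C : ℝ, 0 < C ∧
      ∀ {Ω : Type*} [MeasurableSpace Ω] (P : MeasureTheory.Measure Ω)
        [MeasureTheory.IsProbabilityMeasure P]
        (n : ℕ) (p : ℝ) (b : Fin n → Ω → ℂ) (ε : Fin n → Ω → ℝ),
        -- `b` consists of independent copies of `β`
        (∀ j, ProbabilityTheory.IdentDistrib (b j) β P P₀) →
        ProbabilityTheory.iIndepFun b P →
        -- `ε` consists of independent Bernoulli variables with success probability `p > 0`
        0 < p →
        (∀ j, AEMeasurable (ε j) P) →
        (∀ j, P.real {ω | ε j ω = 1} = p) →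
        (∀ j, P.real {ω | ε j ω = 0} = 1 - p) →
        ProbabilityTheory.iIndepFun ε P →
        -- the two families are independent of each other
        ProbabilityTheory.IndepFun (fun ω j => ε j ω) (fun ω j => b j ω) P →
        ∀ (x : Fin n → ℂ) (a : ℝ), 0 < a →
          (∀ j, a < ‖x j‖ ∧ ‖x j‖ < Cbar * a) →
          ∀ Δ : ℝ, 0 < Δ → Δ < a / (2 * Real.pi) →
            ∀ (j₀ : Fin n) (u v : ℂ),
              P.real {ω | ‖∑ j, (ε j ω : ℂ) * b j ω * x j
                    - (Real.sqrt (n * p) : ℂ) * u * x j₀ - (Real.sqrt (n * p) : ℂ) * v‖ < Δ}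
                ≤ C / ((n : ℝ) * p) ^ (5 / 2 : ℝ) * profileSum x Δ := by
  have hβm : AEMeasurable β P₀ := hβ_int.aemeasurable
  set ν : Measure ℂ := P₀.map β with hν
  have : IsProbabilityMeasure ν := Measure.isProbabilityMeasure_map hβm
  have hmean : ∫ y, y ∂ν = 0 := by
    rw [hν, integral_map hβm (by fun_prop)]
    exact hβ_mean
  have hpos : 0 < ν.real {y : ℂ | c < ‖y‖} := by
    rw [hν, map_measureReal_apply_of_aemeasurable hβm
      (measurableSet_lt (by fun_prop) (by fun_prop))]
    exact hc'.trans_le hβ_nondeg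
  obtain ⟨r, hr, hq⟩ := exists_pos_measure_norm_sub ν hmean hc hpos
  set Q : ℝ := (ν.prod ν).real {q : ℂ × ℂ | r < ‖q.1 - q.2‖} with hQ
  have hQ0 : 0 < Q := lt_of_le_of_ne measureReal_nonneg (Ne.symm hq)
  set S : ℝ := ∑' d : ℤ, exp (-(4 * r ^ 2) * |(d : ℝ)|) with hS
  have hS0 : 0 ≤ S := tsum_nonneg fun _ => (exp_pos _).le
  set C₁ : ℝ := 32 * π * √π * max Cbar 1 * (1 / √(Q / 2)) * (exp (2 * r ^ 2 + 4 * r ^ 2) * S)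
    with hC₁
  set C₂ : ℝ := 2 * (1 + 6 / (Q / 16) ^ 3) * (exp (4 * r ^ 2) * S) with hC₂
  -- The `+ 1` makes positivity immediate from nonnegativity of the other term.
  refine ⟨exp 1 * (exp (1 / r ^ 2) * (C₁ + C₂)) + 1, by positivity, ?_⟩
  intro Ω _ P _ n p b ε hid hbi hp hε h1 h0 hεi hεb x a ha hx Δ hΔ hΔa j₀ u v
  have hn : 0 < n := j₀.pos
  have hn' : (0 : ℝ) < n := by exact_mod_cast hn
  have hp1 : p ≤ 1 := by
    have := h0 j₀
    have h2 : 0 ≤ P.real {ω | ε j₀ ω = 0} := measureReal_nonneg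
    linarith
  have hΔa' : Δ ≤ a := hΔa.le.trans (div_le_self ha.le (by linarith [pi_gt_three]))
  have hb : ∀ j, AEMeasurable (b j) P := fun j => (hid j).aemeasurable_fst
  have hbν : ∀ j, P.map (b j) = ν := fun j => (hid j).map_eq
  have hXm : AEMeasurable (fun ω => ∑ j, (ε j ω : ℂ) * b j ω * x j) P :=
    Finset.aemeasurable_fun_sum _ fun j _ =>
      ((Complex.measurable_ofReal.comp_aemeasurable (hε j)).mul (hb j)).mul_const _
  have : IsProbabilityMeasure (P.map fun ω => ∑ j, (ε j ω : ℂ) * b j ω * x j) :=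
    Measure.isProbabilityMeasure_map hXm
  obtain ⟨z, hz⟩ : ∃ z : ℂ, z = (√(n * p) : ℂ) * u * x j₀ + (√(n * p) : ℂ) * v := ⟨_, rfl⟩
  have hev : P.real {ω | ‖∑ j, (ε j ω : ℂ) * b j ω * x j
      - (√(n * p) : ℂ) * u * x j₀ - (√(n * p) : ℂ) * v‖ < Δ} =
      (P.map fun ω => ∑ j, (ε j ω : ℂ) * b j ω * x j).real (Metric.ball z Δ) := by
    rw [map_measureReal_apply_of_aemeasurable hXm Metric.isOpen_ball.measurableSet]
    congr 1
    ext ω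
    simp [dist_eq_norm, hz, sub_sub]
  rw [hev]
  refine (measureReal_ball_le_integral_charFun _ z hΔ rfl).trans ?_
  simp_rw [charFun_sum_bernoulli_mul hb hbν hbi hε h1 h0 hεi hεb x]
  -- `max Cbar 1` supplies `1 ≤ K` with no assumption on `Cbar`.
  have hmain := integral_gaussian_mul_norm_prod_charFun_le x (K := max Cbar 1) ν hp hp1 ha
    (le_max_right _ _) hΔ hΔa' hr hq (fun j => (hx j).1)
    (fun j => (hx j).2.le.trans (by gcongr; exact le_max_left _ _)) hn rfl
  rw [← hQ, ← hS] at hmain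
  set Y : ℝ := ((n : ℝ) * p) ^ (5 / 2 : ℝ) with hY
  have hY0 : 0 < Y := by positivity
  -- The diagonal term at `j₀` alone bounds the profile sum below, so the exponential error can be
  -- multiplied by it.
  have hprof : 1 ≤ exp (4 * r ^ 2) * S * profileSum x Δ := by
    refine le_trans ?_ (sum_exp_neg_abs_norm_sub_le_profileSum x (Δ := Δ) (ρ := 4 * r ^ 2) hΔ
      (by positivity) fun j => hΔa'.trans_lt (hx j).1)
    calc (1 : ℝ) = exp (-(4 * r ^ 2) * (|‖x j₀‖ - ‖x j₀‖| / Δ)) := by simp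
      _ ≤ ∑ j, exp (-(4 * r ^ 2) * (|‖x j₀‖ - ‖x j‖| / Δ)) :=
        Finset.single_le_sum (f := fun j => exp (-(4 * r ^ 2) * (|‖x j₀‖ - ‖x j‖| / Δ)))
          (fun _ _ => (exp_pos _).le) (Finset.mem_univ j₀)
      _ ≤ _ := Finset.single_le_sum
          (f := fun i => ∑ j, exp (-(4 * r ^ 2) * (|‖x i‖ - ‖x j‖| / Δ)))
          (fun _ _ => Finset.sum_nonneg fun _ _ => (exp_pos _).le) (Finset.mem_univ j₀)
  have hps0 : 0 ≤ profileSum x Δ := tsum_nonneg fun _ => sq_nonneg _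
  have hκ : p / 2 * Q = Q / 2 * p := by ring
  have ht1 : 32 * π * √π * max Cbar 1 / (√(p / 2 * Q * n) * n ^ 2) *
      (exp (2 * r ^ 2 + 4 * r ^ 2) * S * profileSum x Δ) ≤ C₁ / Y * profileSum x Δ := by
    have h2 := one_div_sqrt_mul_sq_le (c := Q / 2) (by positivity) hp hp1 hn
    rw [hκ]
    calc _ = 32 * π * √π * max Cbar 1 * (1 / (√(Q / 2 * p * n) * n ^ 2)) *
          (exp (2 * r ^ 2 + 4 * r ^ 2) * S * profileSum x Δ) := by ring
      _ ≤ 32 * π * √π * max Cbar 1 * (1 / √(Q / 2) / Y) *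
          (exp (2 * r ^ 2 + 4 * r ^ 2) * S * profileSum x Δ) := by gcongr
      _ = _ := by rw [hC₁]; ring
  have ht2 : 2 * exp (-(p / 2 * Q) * n / 8) ≤ C₂ / Y * profileSum x Δ := by
    have h2 := exp_neg_mul_le_div_rpow_five_halves (c := Q / 16) (y := n * p) (by positivity)
      (by positivity)
    rw [show -(p / 2 * Q) * n / 8 = -(Q / 16 * (n * p)) by ring]
    calc 2 * exp (-(Q / 16 * (n * p))) ≤ 2 * ((1 + 6 / (Q / 16) ^ 3) / Y) * 1 := by
          rw [mul_one]; gcongr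
      _ ≤ 2 * ((1 + 6 / (Q / 16) ^ 3) / Y) * (exp (4 * r ^ 2) * S * profileSum x Δ) := by gcongr
      _ = _ := by rw [hC₂]; ring
  have hC₁0 : 0 ≤ C₁ := by positivity
  have hC₂0 : 0 ≤ C₂ := by positivity
  calc _ ≤ exp 1 * (Δ ^ 2 / 4 / π * (π / (Δ ^ 2 / 4) * (exp (1 / r ^ 2) *
        (C₁ / Y * profileSum x Δ + C₂ / Y * profileSum x Δ)))) := by
        gcongr
        exact hmain.trans (by gcongr)
    _ = exp 1 * (exp (1 / r ^ 2) * (C₁ + C₂)) / Y * profileSum x Δ := by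
        field_simp
    _ ≤ (exp 1 * (exp (1 / r ^ 2) * (C₁ + C₂)) + 1) / Y * profileSum x Δ := by
        gcongr
        linarith
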